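/- All Hilbert spaces are real. For set-valued operators $A,B\colon\mathcal H\to 2^{\mathcal H}$ put $\operatorname{dom}A=\{x : Ax\neq\varnothing\}$, $\operatorname{ran}A=\bigcup_x Ax$, $A^{-1}u=\{x : u\in Ax\}$, $J_A=(\mathrm{Id}+A)^{-1}$ and $A\,\square\,B=(A^{-1}+B^{-1})^{-1}$, sums of operators being pointwise Minkowski sums; $A$ is monotone if $\langle x-y, u-v\rangle\ge 0$ for all $u\in Ax$, $v\in Ay$, $\nu$-strongly monotone if $\langle x-y, u-v\rangle\ge\nu\|x-y\|^2$ for all $u\in Ax$, $v\in Ay$, and maximally monotone if it is monotone and no monotone operator has a strictly larger graph. $\Gamma_0(\mathcal H)$ is the class of lower semicontinuous convex functions $f\colon\mathcal H\to\,]-\infty,+\infty]$ with $\operatorname{dom}f=\{x : f(x)<+\infty\}\neq\varnothing$, and $\partial f(x)=\{u : \langle y-x, u\rangle+f(x)\le f(y)\ \text{for all } y\in\mathcal H\}$. The conical hull of a set $C$ is $\{\lambda c : \lambda>0,\ c\in C\}$; $\operatorname{sri}C$ is the set of $x\in C$ such that the conical hull of $-x+C$ is a closed vector subspace; $\operatorname{ri}$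 is the relative interior. Let $\mathcal H$ be a Hilbert space, let $\rho>0$, let $A\colon\mathcal H\to 2^{\mathcal H}$ be maximally monotone, and let $m\ge 1$ be an integer. For every $i\in\{1,\dots,m\}$ let $\mathcal G_i$ be a Hilbert space, let $r_i\in\mathcal G_i$, let $B_i\colon\mathcal G_i\to 2^{\mathcal G_i}$ be maximally monotone, let $\nu_i>0$, let $D_i\colon\mathcal G_i\to 2^{\mathcal G_i}$ be maximally monotone and $\nu_i$-strongly monotone, and let $L_i\colon\mathcal H\to\mathcal G_i$ be a nonzero bounded linear operator. Let $\mathcal G_1\oplus\dots\oplus\mathcal G_m$ be the Hilbert direct sum. Set $$M\colon x\mapsto Ax+\sum_{i=1}^m L_i^*\big((B_i\,\square\,D_i)(L_ix-r_i)\big).$$ Suppose first that $z\in\mathcal H$ satisfies the range condition $z\in\operatorname{ran}(M+\rho\,\mathrm{Id})$. Then $J_{\rho^{-1}M}(\rho^{-1}z)$ is a singleton $\{\overline x\}$, and the following hold. (i) $\overline x$ is the unique solution of the primal inclusion $z\in Mx+\rho x$. (ii) The dual inclusion: find $(v_i)_{1\le i\le m}\in\mathcal G_1\times\dots\times\mathcal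 G_m$ such that $$(\forall i\in\{1,\dots,m\})\quad r_i\in L_i\Big(J_{\rho^{-1}A}\Big(\rho^{-1}\Big(z-\sum_{j=1}^m L_j^*v_j\Big)\Big)\Big)-B_i^{-1}v_i-D_i^{-1}v_i,$$ has at least one solution. (iii) For every solution $(v_1,\dots,v_m)$ of the dual inclusion, $J_{\rho^{-1}A}\big(\rho^{-1}\big(z-\sum_{i=1}^m L_i^*v_i\big)\big)=\{\overline x\}$. (iv) Moreover, the range condition holds for every $z\in\mathcal H$ if and only if $M$ is maximally monotone. This is the case if (a) or (b) below holds. (a) The conical hull of $$E=\big\{(L_ix-r_i-v_i)_{1\le i\le m} : x\in\operatorname{dom}A,\ v_i\in\operatorname{ran}(B_i^{-1}+D_i^{-1})\ \text{for every } i\big\}$$ is a closed vector subspace of $\mathcal G_1\oplus\dots\oplus\mathcal G_m$. (b) $A=\partial f$ for some $f\in\Gamma_0(\mathcal H)$ and, for every $i$, $B_i=\partial g_i$ for some $g_i\in\Gamma_0(\mathcal G_i)$ and $D_i=\partial\ell_i$ for some strongly convex $\ell_i\in\Gamma_0(\mathcal G_i)$, and one of the following holds: 1. $(r_1,\dots,r_m)\in\operatorname{sri}\big\{(L_ix-y_i)_{1\le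 i\le m} : x\in\operatorname{dom}f,\ y_i\in\operatorname{dom}g_i+\operatorname{dom}\ell_i\ \text{for every } i\big\}$; 2. for every $i$, $g_i$ or $\ell_i$ is real-valued; 3. $\mathcal H$ and all $\mathcal G_i$ are finite-dimensional, and there exists $x\in\operatorname{ri}\operatorname{dom}f$ such that $L_ix-r_i\in\operatorname{ri}\operatorname{dom}g_i+\operatorname{ri}\operatorname{dom}\ell_i$ for every $i$. -/

import Mathlib

open scoped Pointwise

namespace MonotoneInclusion

section Operators

variable {E : Type*}

/-- The domain of a set-valued operator: the points with a nonempty image. -/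
def domOp (A : E → Set E) : Set E := {x | (A x).Nonempty}

/-- The range of a set-valued operator. -/
def ranOp (A : E → Set E) : Set E := {u | ∃ x, u ∈ A x}

/-- The inverse of a set-valued operator. -/
def invOp (A : E → Set E) : E → Set E := fun u => {x | u ∈ A x}

/-- The identity as a set-valued operator. -/
def idOp : E → Set E := fun x => {x}

variable [NormedAddCommGroup E] [InnerProductSpace ℝ E]

/-- The resolvent `(Id + A)⁻¹` of a set-valued operator, itself a set-valued operator.
The sum of operators is the pointwise Minkowski sum. -/
def resolventOp (A : E → Set E) : E → Set E := invOp (idOp + A)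

/-- The parallel sum `(A⁻¹ + B⁻¹)⁻¹` of two set-valued operators. -/
def parSum (A B : E → Set E) : E → Set E := invOp (invOp A + invOp B)

/-- Monotone set-valued operators. -/
def IsMonotone (A : E → Set E) : Prop :=
  ∀ x y, ∀ u ∈ A x, ∀ v ∈ A y, 0 ≤ inner ℝ (x - y) (u - v)

/-- Maximally monotone operators: no monotone operator has a strictly larger graph. -/
def IsMaximallyMonotone (A : E → Set E) : Prop :=
  IsMonotone A ∧ ∀ B : E → Set E, IsMonotone B → (∀ x, A x ⊆ B x) → A = B

/-- `ν`-strongly monotone set-valued operators. -/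
def IsStronglyMonotone (ν : ℝ) (A : E → Set E) : Prop :=
  ∀ x y, ∀ u ∈ A x, ∀ v ∈ A y, ν * ‖x - y‖ ^ 2 ≤ inner ℝ (x - y) (u - v)

end Operators

section ConvexAnalysis

variable {E : Type*} [NormedAddCommGroup E] [InnerProductSpace ℝ E]

/-- The effective domain of an extended-real-valued function. -/
def effDom (f : E → EReal) : Set E := {x | f x < ⊤}

/-- The class `Γ₀` of lower semicontinuous convex functions with values in `]-∞, +∞]` and a
nonempty effective domain. -/
structure IsGammaZero (f : E → EReal) : Prop where
  ne_bot : ∀ x, f x ≠ ⊥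
  nonempty : (effDom f).Nonempty
  lsc : LowerSemicontinuous f
  convex : ∀ x y : E, ∀ a b : ℝ, 0 < a → 0 < b → a + b = 1 →
    f (a • x + b • y) ≤ (a : EReal) * f x + (b : EReal) * f y

/-- Strong convexity (for some modulus `c > 0`) of a function with values in `]-∞, +∞]`. -/
def IsStronglyConvex (f : E → EReal) : Prop :=
  ∃ c : ℝ, 0 < c ∧ ∀ x y : E, ∀ a b : ℝ, 0 < a → 0 < b → a + b = 1 →
    f (a • x + b • y) + ((a * b * (c / 2) * ‖x - y‖ ^ 2 : ℝ) : EReal)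
      ≤ (a : EReal) * f x + (b : EReal) * f y

/-- The subdifferential of a function with values in `]-∞, +∞]`. -/
def subdiff (f : E → EReal) : E → Set E :=
  fun x => {u | ∀ y, ((inner ℝ (y - x) u : ℝ) : EReal) + f x ≤ f y}

/-- Functions with finite values everywhere. -/
def IsRealValued (f : E → EReal) : Prop := ∀ x, ∃ t : ℝ, f x = (t : EReal)

/-- The conical hull of a set `C`: the smallest set containing `C` that is closed under
multiplication by strictly positive scalars. -/
def coneHull (C : Set E) : Set E := {y | ∃ t : ℝ, 0 < t ∧ ∃ c ∈ C, y = t • c}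

/-- The set `C` is a closed vector subspace. -/
def IsClosedSubspace (C : Set E) : Prop :=
  ∃ S : Submodule ℝ E, IsClosed (S : Set E) ∧ (S : Set E) = C

/-- The strong relative interior of `C`: the points `x` of `C` such that the conical hull of
`-x + C` is a closed vector subspace. -/
def sri (C : Set E) : Set E :=
  {x | x ∈ C ∧ IsClosedSubspace (coneHull ((fun c => -x + c) '' C))}

end ConvexAnalysis

section Problem

variable {H : Type*} [NormedAddCommGroup H] [InnerProductSpace ℝ H] [CompleteSpace H]
  {m : ℕ} {G : Fin m → Type*} [∀ i, NormedAddCommGroup (G i)]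
  [∀ i, InnerProductSpace ℝ (G i)] [∀ i, CompleteSpace (G i)]

/-- The operator `x ↦ A x + ∑ i, Lᵢ* ((Bᵢ □ Dᵢ) (Lᵢ x - rᵢ))`. -/
noncomputable def compositeOp (A : H → Set H) (B D : ∀ i, G i → Set (G i))
    (L : ∀ i, H →L[ℝ] G i) (r : ∀ i, G i) : H → Set H :=
  fun x => A x +
    ∑ i, ContinuousLinearMap.adjoint (L i) '' (parSum (B i) (D i) (L i x - r i))

/-- `x` solves the primal inclusion
`z ∈ A x + ∑ i, Lᵢ* ((Bᵢ □ Dᵢ) (Lᵢ x - rᵢ)) + ρ x`. -/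
def IsPrimalSolution (ρ : ℝ) (A : H → Set H) (B D : ∀ i, G i → Set (G i))
    (L : ∀ i, H →L[ℝ] G i) (r : ∀ i, G i) (z x : H) : Prop :=
  z ∈ compositeOp A B D L r x + {ρ • x}

/-- `v = (vᵢ)ᵢ` solves the dual inclusion: for every `i`,
`rᵢ ∈ Lᵢ (J (ρ⁻¹ (z - ∑ j, Lⱼ* vⱼ))) - Bᵢ⁻¹ vᵢ - Dᵢ⁻¹ vᵢ`, where `J` is the resolvent of
`ρ⁻¹ A`. -/
def IsDualSolution (ρ : ℝ) (A : H → Set H) (B D : ∀ i, G i → Set (G i))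
    (L : ∀ i, H →L[ℝ] G i) (r : ∀ i, G i) (z : H) (v : ∀ i, G i) : Prop :=
  ∀ i, r i ∈
    L i '' resolventOp (ρ⁻¹ • A) (ρ⁻¹ • (z - ∑ j, ContinuousLinearMap.adjoint (L j) (v j)))
      - invOp (B i) (v i) - invOp (D i) (v i)

/-- The set of all `(Lᵢ x - rᵢ - vᵢ)ᵢ` with `x ∈ dom A` and `vᵢ ∈ ran (Bᵢ⁻¹ + Dᵢ⁻¹)`, in the
Hilbert direct sum of the spaces `Gᵢ`. -/
def qualSet (A : H → Set H) (B D : ∀ i, G i → Set (G i))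
    (L : ∀ i, H →L[ℝ] G i) (r : ∀ i, G i) : Set (PiLp 2 G) :=
  {w | ∃ x ∈ domOp A, ∃ v : ∀ i, G i, (∀ i, v i ∈ ranOp (invOp (B i) + invOp (D i))) ∧
    ∀ i, w i = L i x - r i - v i}

/-- The set of all `(Lᵢ x - yᵢ)ᵢ` with `x ∈ dom f` and `yᵢ ∈ dom gᵢ + dom ℓᵢ`, in the Hilbert
direct sum of the spaces `Gᵢ`. -/
def qualSetFun (f : H → EReal) (g l : ∀ i, G i → EReal)
    (L : ∀ i, H →L[ℝ] G i) : Set (PiLp 2 G) :=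
  {w | ∃ x ∈ effDom f, ∃ y : ∀ i, G i, (∀ i, y i ∈ effDom (g i) + effDom (l i)) ∧
    ∀ i, w i = L i x - y i}

end Problem

end MonotoneInclusion

open MonotoneInclusion

namespace MonotoneInclusion

open Filter Topology

/-! Minty's theorem turns the range condition into maximality: a monotone `M` on a Hilbert space is
maximally monotone exactly when `M + ρ Id` is onto. For a single `z` only monotonicity of `M`
matters. It makes the primal solution unique, and decomposing `z - ρ x ∈ M x` into an element of `A
x` and elements `vᵢ ∈ (Bᵢ □ Dᵢ) (Lᵢ x - rᵢ)` is the same as solving the dual inclusion, with `x`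
recovered as a resolvent value of `A`.

For maximality, strong monotonicity makes each `Dᵢ⁻¹` a single-valued Lipschitz map, so every `Bᵢ □
Dᵢ` is maximally monotone (`IsMaximallyMonotone.parSum`). In the Hilbert direct sum, `M` becomes `A
+ L* C L` with one operator `L` and one maximally monotone `C` (`compositeOp_eq`).

The core is `IsMaximallyMonotone.add_adjoint_comp`. Replacing `C` by its Yosida approximation of
index `l` gives a solvable problem with solution `(x, v)`, and `l → 0`. The vectors `v` lie in the
closed subspace `S` spanned by the qualification set; finiteness of the Fitzpatrick functions of `A`
and `C` bounds `⟪w, v⟫` for each `w ∈ S`, and Banach-Steinhaus bounds `‖v‖`. Monotonicity then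
upgrades boundedness to strong convergence of both sequences, and graphs of maximally monotone
operators are closed.

Both kinds of qualification condition fit because the set only has to lie between differences of
operator domains and differences of the larger Fitzpatrick domains. For subdifferentials the latter
contain the effective domains; conditions 2 and 3 imply condition 1. -/

theorem mem_parSum {E : Type*} [NormedAddCommGroup E] {B D : E → Set E} {x u : E} :
    u ∈ parSum B D x ↔ ∃ b d, u ∈ B b ∧ u ∈ D d ∧ b + d = x := by
  simp only [parSum, invOp, Set.mem_ofPred_eq, Pi.add_apply, Set.mem_add]
  constructor
  · rintro ⟨b, hb, d, hd, h⟩; exact ⟨b, d, hb, hd, h⟩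
  · rintro ⟨b, d, hb, hd, h⟩; exact ⟨b, hb, d, hd, h⟩

/-! ### Minty's theorem and maximality of Lipschitz perturbations and parallel sums. -/

section Minty

variable {E : Type*} [NormedAddCommGroup E] [InnerProductSpace ℝ E]

/-- Adjoining `(x, u)` to the graph keeps it monotone, so maximality forces the pair to be there
already. -/
theorem IsMaximallyMonotone.mem_of_forall {A : E → Set E} (hA : IsMaximallyMonotone A) {x u : E}
    (h : ∀ a, ∀ b ∈ A a, 0 ≤ inner ℝ (x - a) (u - b)) : u ∈ A x := by
  let B : E → Set E := fun y => A y ∪ {w | y = x ∧ w = u}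
  have hB : IsMonotone B := by
    rintro y y' w (hw | ⟨rfl, rfl⟩) w' (hw' | ⟨rfl, rfl⟩)
    · exact hA.1 _ _ _ hw _ hw'
    · have := h _ _ hw
      rwa [← inner_neg_neg, neg_sub, neg_sub]
    · exact h _ _ hw'
    · simp
  have hAB := hA.2 B hB fun y => Set.subset_union_left
  rw [hAB]
  exact Or.inr ⟨rfl, rfl⟩

theorem IsMonotone.isMaximallyMonotone {A : E → Set E} (hA : IsMonotone A)
    (h : ∀ x u, (∀ a, ∀ b ∈ A a, 0 ≤ inner ℝ (x - a) (u - b)) → u ∈ A x) :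
    IsMaximallyMonotone A := by
  refine ⟨hA, fun B hB hAB => ?_⟩
  funext x
  refine (hAB x).antisymm fun u hu => h x u fun a b hb => hB _ _ _ hu _ (hAB a hb)

theorem IsMaximallyMonotone.exists_mem {A : E → Set E} (hA : IsMaximallyMonotone A) :
    ∃ x u, u ∈ A x := by
  by_contra! h
  exact h 0 0 (hA.mem_of_forall fun a b hb => absurd hb (h a b))

theorem IsMaximallyMonotone.invOp {A : E → Set E} (hA : IsMaximallyMonotone A) :
    IsMaximallyMonotone (invOp A) := by
  refine IsMonotone.isMaximallyMonotone (fun x y u hu v hv => ?_) fun x u h => ?_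
  · rw [real_inner_comm]
    exact hA.1 _ _ _ hu _ hv
  · refine hA.mem_of_forall fun a b hb => ?_
    rw [real_inner_comm]
    exact h b a hb

/-- A closed convex set of pairs `(p, t)` on which `t + ‖p‖² / 2` is bounded below has a point
minimizing this quantity. -/
theorem exists_forall_add_half_sq_norm_le [CompleteSpace E] {K : Set (E × ℝ)} (hK : IsClosed K)
    (hne : K.Nonempty) (hc : Convex ℝ K) {β : ℝ} (hβ : ∀ p ∈ K, β ≤ p.2 + ‖p.1‖ ^ 2 / 2) :
    ∃ p ∈ K, ∀ q ∈ K, p.2 + ‖p.1‖ ^ 2 / 2 ≤ q.2 + ‖q.1‖ ^ 2 / 2 := by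
  let φ : E × ℝ → ℝ := fun p => p.2 + ‖p.1‖ ^ 2 / 2
  have hbdd : BddBelow (φ '' K) := ⟨β, by rintro _ ⟨p, hp, rfl⟩; exact hβ p hp⟩
  set I := sInf (φ '' K) with hI
  have hIle : ∀ p ∈ K, I ≤ φ p := fun p hp => csInf_le hbdd ⟨p, hp, rfl⟩
  have hex : ∀ n : ℕ, ∃ p ∈ K, φ p < I + 1 / ((n : ℝ) + 1) := fun n => by
    obtain ⟨_, ⟨p, hp, rfl⟩, h⟩ := exists_lt_of_csInf_lt (hne.image φ)
      (show sInf (φ '' K) < I + 1 / ((n : ℝ) + 1) from lt_add_of_pos_right _ (by positivity))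
    exact ⟨p, hp, h⟩
  choose p hpK hpI using hex
  -- The midpoint has value at least `I`, and the parallelogram law converts the small gap into
  -- closeness: strong convexity of the half square makes minimizing sequences Cauchy.
  have hmid : ∀ n k, ‖(p n).1 - (p k).1‖ ^ 2 ≤ 4 * (1 / ((n : ℝ) + 1)) + 4 * (1 / ((k : ℝ) + 1)) := by
    intro n k
    have h1 := hIle _ (hc (hpK n) (hpK k) (by norm_num : (0 : ℝ) ≤ 1 / 2)
      (by norm_num : (0 : ℝ) ≤ 1 / 2) (by norm_num))
    have h2 := hpI n
    have h3 := hpI k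
    simp only [φ, Prod.fst_add, Prod.snd_add, Prod.smul_fst, Prod.smul_snd, smul_eq_mul,
      ← smul_add, norm_smul] at h1 h2 h3
    have h4 := parallelogram_law_with_norm ℝ (p n).1 (p k).1
    norm_num [mul_pow] at h1
    nlinarith
  have hlim : Tendsto (fun n : ℕ => 1 / ((n : ℝ) + 1)) atTop (𝓝 0) :=
    tendsto_one_div_add_atTop_nhds_zero_nat
  have hcau : CauchySeq fun n => (p n).1 := by
    rw [Metric.cauchySeq_iff]
    intro ε hε
    obtain ⟨N, hN⟩ := (hlim.eventually (gt_mem_nhds (show 0 < ε ^ 2 / 8 by positivity))).exists_forall_of_atTop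
    refine ⟨N, fun n hn k hk => ?_⟩
    rw [dist_eq_norm]
    refine lt_of_pow_lt_pow_left₀ 2 hε.le ?_
    have := hmid n k
    have := hN n hn
    have := hN k hk
    linarith
  obtain ⟨x, hx⟩ := cauchySeq_tendsto_of_complete hcau
  have hφ : Tendsto (fun n => φ (p n)) atTop (𝓝 I) :=
    tendsto_of_tendsto_of_tendsto_of_le_of_le tendsto_const_nhds
      (by simpa using hlim.const_add I) (fun n => hIle _ (hpK n)) fun n => (hpI n).le
  have ht : Tendsto (fun n => (p n).2) atTop (𝓝 (I - ‖x‖ ^ 2 / 2)) := by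
    refine (hφ.sub ((hx.norm.pow 2).div_const 2)).congr fun n => ?_
    simp [φ]
  refine ⟨(x, I - ‖x‖ ^ 2 / 2), hK.mem_of_tendsto (hx.prodMk_nhds ht)
    (Eventually.of_forall hpK), fun q hq => ?_⟩
  have := hIle q hq
  simpa [φ] using this

/-- The first order optimality condition for a minimizer of `t + ‖p‖² / 2`. -/
theorem sub_inner_le_of_forall_add_half_sq_norm_le {K : Set (E × ℝ)} (hc : Convex ℝ K)
    {p : E × ℝ} (hp : p ∈ K) (hmin : ∀ q ∈ K, p.2 + ‖p.1‖ ^ 2 / 2 ≤ q.2 + ‖q.1‖ ^ 2 / 2)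
    {q : E × ℝ} (hq : q ∈ K) : p.2 - inner ℝ p.1 (q.1 - p.1) ≤ q.2 := by
  -- Minimality is tested on the segment from `p` to `q`; the inequality is divided by `s`, which
  -- then tends to `0`.
  have key : ∀ s : ℝ, 0 < s → s ≤ 1 →
      0 ≤ q.2 - p.2 + inner ℝ p.1 (q.1 - p.1) + s * (‖q.1 - p.1‖ ^ 2 / 2) := by
    intro s hs hs1
    have h := hmin _ (hc hp hq (sub_nonneg.2 hs1) hs.le (by ring))
    simp only [Prod.fst_add, Prod.snd_add, Prod.smul_fst, Prod.smul_snd, smul_eq_mul] at h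
    have e : (1 - s) • p.1 + s • q.1 = p.1 + s • (q.1 - p.1) := by module
    rw [e, norm_add_sq_real, inner_smul_right, norm_smul, mul_pow, Real.norm_eq_abs, sq_abs] at h
    refine nonneg_of_mul_nonneg_right (a := s) ?_ hs
    nlinarith
  have hlim : Tendsto (fun s : ℝ => q.2 - p.2 + inner ℝ p.1 (q.1 - p.1)
      + s * (‖q.1 - p.1‖ ^ 2 / 2)) (𝓝[>] 0)
      (𝓝 (q.2 - p.2 + inner ℝ p.1 (q.1 - p.1) + 0 * (‖q.1 - p.1‖ ^ 2 / 2))) :=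
    Tendsto.mono_left (Continuous.tendsto (by fun_prop) _) nhdsWithin_le_nhds
  have := ge_of_tendsto hlim (by
    filter_upwards [Ioc_mem_nhdsGT (zero_lt_one' ℝ)] with s hs using key s hs.1 hs.2)
  linarith

/-- The Fitzpatrick function plus half the squared norm attains its minimum at some `(x, u)`.
Optimality makes `(-u, -x)` monotonically related to the graph, hence a member of it, and then
forces `u = -x`. -/
theorem IsMaximallyMonotone.exists_neg_mem [CompleteSpace E] {A : E → Set E}
    (hA : IsMaximallyMonotone A) : ∃ x, -x ∈ A x := by
  -- The epigraph of the Fitzpatrick function of `A`; the `L²` product norm makes the pairs a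
  -- Hilbert space.
  let K : Set (WithLp 2 (E × E) × ℝ) :=
    {p | ∀ a, ∀ b ∈ A a, inner ℝ p.1.fst b + inner ℝ a p.1.snd - inner ℝ a b ≤ p.2}
  have hfst : Continuous fun p : WithLp 2 (E × E) => p.fst := by fun_prop
  have hsnd : Continuous fun p : WithLp 2 (E × E) => p.snd := by fun_prop
  have hKc : IsClosed K := by
    have : K = ⋂ a, ⋂ b ∈ A a,
        {p | inner ℝ p.1.fst b + inner ℝ a p.1.snd - inner ℝ a b ≤ p.2} := by
      ext p; simp [K]
    rw [this]
    refine isClosed_iInter fun a => isClosed_iInter fun b => isClosed_iInter fun _ =>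
      isClosed_le ?_ continuous_snd
    exact (((hfst.comp continuous_fst).inner continuous_const).add
      (continuous_const.inner (hsnd.comp continuous_fst))).sub continuous_const
  have hconv : Convex ℝ K := by
    intro p hp q hq s t hs ht hst a b hb
    have h1 := mul_le_mul_of_nonneg_left (hp a b hb) hs
    have h2 := mul_le_mul_of_nonneg_left (hq a b hb) ht
    simp only [Prod.fst_add, Prod.snd_add, Prod.smul_fst, Prod.smul_snd, smul_eq_mul,
      WithLp.add_fst, WithLp.add_snd, WithLp.smul_fst, WithLp.smul_snd, inner_add_left,
      inner_add_right, inner_smul_left, inner_smul_right, RCLike.conj_to_real]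
    have : inner ℝ a b = s * inner ℝ a b + t * inner ℝ a b := by rw [← add_mul, hst, one_mul]
    linarith
  have hgr : ∀ a, ∀ b ∈ A a, ((WithLp.toLp 2 (a, b), inner ℝ a b) : WithLp 2 (E × E) × ℝ) ∈ K := by
    intro a b hb a' b' hb'
    have := hA.1 _ _ _ hb _ hb'
    simp only [inner_sub_left, inner_sub_right] at this
    change inner ℝ a b' + inner ℝ a' b - inner ℝ a' b' ≤ inner ℝ a b
    linarith
  -- The Fitzpatrick function dominates the duality product. A strict failure would make the pair
  -- monotonically related to the graph, hence a member, and testing with the pair itself is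
  -- contradictory.
  have hle : ∀ p ∈ K, inner ℝ p.1.fst p.1.snd ≤ p.2 := by
    intro p hp
    by_contra! h
    have hmem : p.1.snd ∈ A p.1.fst := hA.mem_of_forall fun a b hb => by
      have := hp a b hb
      simp only [inner_sub_left, inner_sub_right]
      linarith
    have := hp _ _ hmem
    linarith
  have hnorm : ∀ p : WithLp 2 (E × E), ‖p‖ ^ 2 = ‖p.fst‖ ^ 2 + ‖p.snd‖ ^ 2 :=
    WithLp.prod_norm_sq_eq_of_L2
  have hβ : ∀ p ∈ K, (0 : ℝ) ≤ p.2 + ‖p.1‖ ^ 2 / 2 := by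
    intro p hp
    have h1 := hle p hp
    have h2 := norm_add_sq_real p.1.fst p.1.snd
    have h3 := sq_nonneg ‖p.1.fst + p.1.snd‖
    rw [hnorm]
    linarith
  obtain ⟨a₀, b₀, h₀⟩ := hA.exists_mem
  obtain ⟨p, hp, hmin⟩ := exists_forall_add_half_sq_norm_le hKc ⟨_, hgr a₀ b₀ h₀⟩ hconv hβ
  have hopt : ∀ a, ∀ b ∈ A a, ‖p.1.fst + p.1.snd‖ ^ 2 ≤
      inner ℝ (-p.1.snd - a) (-p.1.fst - b) := by
    intro a b hb
    have h1 := sub_inner_le_of_forall_add_half_sq_norm_le hconv hp hmin (hgr a b hb)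
    have h2 := hle p hp
    rw [WithLp.prod_inner_apply] at h1
    change p.2 - (inner ℝ p.1.fst (a - p.1.fst) + inner ℝ p.1.snd (b - p.1.snd)) ≤ inner ℝ a b at h1
    simp only [inner_sub_right, real_inner_self_eq_norm_sq] at h1
    have e1 := real_inner_comm p.1.fst a
    have e2 := real_inner_comm p.1.fst p.1.snd
    simp only [inner_sub_left, inner_sub_right, inner_neg_left, inner_neg_right]
    rw [norm_add_sq_real]
    linarith
  have hmem : -p.1.fst ∈ A (-p.1.snd) := hA.mem_of_forall fun a b hb =>
    (sq_nonneg _).trans (hopt a b hb)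
  have h0 := hopt _ _ hmem
  simp only [sub_self, inner_zero_left] at h0
  have h1 : p.1.fst + p.1.snd = 0 := by
    rw [← norm_eq_zero]; exact pow_eq_zero_iff two_ne_zero |>.1 (le_antisymm h0 (sq_nonneg _))
  refine ⟨p.1.fst, ?_⟩
  rwa [← eq_neg_of_add_eq_zero_left h1] at hmem

/-- Minty's theorem. -/
theorem IsMaximallyMonotone.exists_add_smul_eq [CompleteSpace E] {A : E → Set E}
    (hA : IsMaximallyMonotone A) {μ : ℝ} (hμ : 0 < μ) (z : E) :
    ∃ x, ∃ u ∈ A x, x + μ • u = z := by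
  -- This operator is `μ A - z`; a point with `-x ∈ μ A x - z` solves the equation.
  have hA' : IsMaximallyMonotone fun x => {w | μ⁻¹ • (w + z) ∈ A x} := by
    refine IsMonotone.isMaximallyMonotone (fun x y u hu v hv => ?_) fun x u h => ?_
    · have := hA.1 _ _ _ hu _ hv
      rw [← smul_sub, add_sub_add_right_eq_sub, inner_smul_right] at this
      exact nonneg_of_mul_nonneg_right this (inv_pos.2 hμ)
    · refine hA.mem_of_forall fun a b hb => ?_
      have := h a (μ • b - z) (by
        simpa only [Set.mem_ofPred_eq, sub_add_cancel, smul_smul, inv_mul_cancel₀ hμ.ne', one_smul] using hb)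
      have e : μ⁻¹ • (u + z) - b = μ⁻¹ • (u - (μ • b - z)) := by
        rw [smul_sub, smul_sub, smul_smul, inv_mul_cancel₀ hμ.ne', one_smul, smul_add]; abel
      rw [e, inner_smul_right]
      exact mul_nonneg (inv_pos.2 hμ).le this
  obtain ⟨x, hx⟩ := hA'.exists_neg_mem
  refine ⟨x, _, hx, ?_⟩
  rw [smul_smul, mul_inv_cancel₀ hμ.ne', one_smul]; abel

/-- Converse of Minty's theorem. If `(x, u)` is related to the graph, pick a graph point `(a, b)`
with `a + μ b = x + μ u`; then `⟪x - a, u - b⟫ = -μ ‖u - b‖²` must be nonnegative, so the two pairs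
agree. -/
theorem IsMonotone.isMaximallyMonotone_of_surjective {A : E → Set E} (hA : IsMonotone A) {μ : ℝ}
    (hμ : 0 < μ) (h : ∀ z, ∃ x, ∃ u ∈ A x, x + μ • u = z) : IsMaximallyMonotone A := by
  refine hA.isMaximallyMonotone fun x u hxu => ?_
  obtain ⟨a, b, hb, hab⟩ := h (x + μ • u)
  have h1 := hxu a b hb
  have e : x - a = -(μ • (u - b)) := by
    rw [smul_sub, neg_sub, sub_eq_sub_iff_add_eq_add, ← hab]; abel
  rw [e, inner_neg_left, inner_smul_left, real_inner_self_eq_norm_sq, RCLike.conj_to_real] at h1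
  have h2 : ‖u - b‖ ^ 2 = 0 := by
    have := sq_nonneg ‖u - b‖
    nlinarith
  have h3 : u = b := sub_eq_zero.1 (norm_eq_zero.1 (pow_eq_zero_iff two_ne_zero |>.1 h2))
  have h4 : x = a := by rw [h3] at hab; exact (add_right_cancel hab).symm
  rwa [h3, h4]

/-- Points with resolvent-type representations depend on the data in a nonexpansive way. -/
theorem IsMonotone.norm_sub_le {A : E → Set E} (hA : IsMonotone A) {μ : ℝ}
    (hμ : 0 < μ) {x y u v : E} (hu : u ∈ A x) (hv : v ∈ A y) :
    ‖x - y‖ ≤ ‖(x + μ • u) - (y + μ • v)‖ := by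
  have h := hA _ _ _ hu _ hv
  refine le_of_sq_le_sq ?_ (norm_nonneg _)
  have e : (x + μ • u) - (y + μ • v) = (x - y) + μ • (u - v) := by module
  rw [e, norm_add_sq_real, inner_smul_right]
  have := mul_nonneg hμ.le h
  have := sq_nonneg ‖μ • (u - v)‖
  linarith

/-- `z ∈ x + μ (A x + T x)` says that `x` is fixed by `x ↦ J (z - μ T x)`, where `J` is the
nonexpansive resolvent of `μ A`; for small `μ` this is a contraction. -/
theorem IsMaximallyMonotone.add_lipschitz [CompleteSpace E] {A : E → Set E}
    (hA : IsMaximallyMonotone A) {T : E → E} {k : NNReal} (hT : LipschitzWith k T)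
    (hTm : ∀ x y, 0 ≤ inner ℝ (x - y) (T x - T y)) :
    IsMaximallyMonotone fun x => {w | w - T x ∈ A x} := by
  -- With this `μ` the contraction constant is `μ k = k / (k + 1) < 1`.
  have hμ : (0 : ℝ) < 1 / (k + 1) := by positivity
  set μ : ℝ := 1 / (k + 1) with hμdef
  refine IsMonotone.isMaximallyMonotone_of_surjective (fun x y u hu v hv => ?_) hμ fun z => ?_
  · have h1 := hA.1 _ _ _ hu _ hv
    have h2 := hTm x y
    have e : u - v = (u - T x - (v - T y)) + (T x - T y) := by abel
    rw [e, inner_add_right]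
    linarith
  · choose J U hU hJ using fun y => hA.exists_add_smul_eq hμ y
    have hc : ContractingWith (k / (k + 1)) fun x => J (z - μ • T x) := by
      refine ⟨by rw [div_lt_one (by positivity)]; exact lt_add_one k, LipschitzWith.of_dist_le_mul fun x y => ?_⟩
      rw [dist_eq_norm, dist_eq_norm]
      refine (hA.1.norm_sub_le hμ (hU (z - μ • T x)) (hU (z - μ • T y))).trans ?_
      rw [hJ, hJ]
      have e : z - μ • T x - (z - μ • T y) = -(μ • (T x - T y)) := by module
      have h := hT.dist_le_mul x y
      rw [dist_eq_norm, dist_eq_norm] at h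
      rw [e, norm_neg, norm_smul, Real.norm_of_nonneg hμ.le]
      refine (mul_le_mul_of_nonneg_left h hμ.le).trans (le_of_eq ?_)
      rw [hμdef]
      push_cast
      ring
    have hfix := hc.fixedPoint_isFixedPt
    set x := ContractingWith.fixedPoint _ hc with hx
    have hfix' : J (z - μ • T x) = x := hfix
    have h1 := hU (z - μ • T x)
    have h2 := hJ (z - μ • T x)
    rw [hfix'] at h1 h2
    refine ⟨x, U (z - μ • T x) + T x, by simpa using h1, ?_⟩
    rw [smul_add, ← add_assoc, h2, sub_add_cancel]

/-- `D - ν Id` is still maximally monotone, so Minty's theorem makes `D` onto; strong monotonicity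
makes the inverse single-valued and `ν⁻¹`-Lipschitz. -/
theorem IsMaximallyMonotone.exists_lipschitz_inverse [CompleteSpace E] {D : E → Set E}
    (hD : IsMaximallyMonotone D) {ν : ℝ} (hν : 0 < ν) (hDν : IsStronglyMonotone ν D) :
    ∃ T : E → E, (∃ k, LipschitzWith k T) ∧ ∀ x u, u ∈ D x ↔ x = T u := by
  have hD' : IsMaximallyMonotone fun x => {w | w + ν • x ∈ D x} := by
    refine IsMonotone.isMaximallyMonotone (fun x y u hu v hv => ?_) fun x u h => ?_
    · have := hDν _ _ _ hu _ hv
      have e : u + ν • x - (v + ν • y) = (u - v) + ν • (x - y) := by module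
      rw [e, inner_add_right, inner_smul_right, real_inner_self_eq_norm_sq] at this
      linarith
    · refine hD.mem_of_forall fun a b hb => ?_
      have := h a (b - ν • a) (by simpa using hb)
      have e : u + ν • x - b = (u - (b - ν • a)) + ν • (x - a) := by module
      rw [e, inner_add_right, inner_smul_right, real_inner_self_eq_norm_sq]
      positivity
  have hsurj : ∀ u, ∃ x, u ∈ D x := fun u => by
    obtain ⟨x, w, hw, hxw⟩ := hD'.exists_add_smul_eq (inv_pos.2 hν) (ν⁻¹ • u)
    refine ⟨x, ?_⟩
    have : u = w + ν • x := by
      rw [← smul_right_injective E (inv_pos.2 hν).ne' |>.eq_iff]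
      simp only [smul_add, smul_smul, inv_mul_cancel₀ hν.ne', one_smul, ← hxw]
      abel
    rw [this]; exact hw
  choose T hT using hsurj
  have hbound : ∀ x y, ∀ u ∈ D x, ∀ v ∈ D y, ‖x - y‖ ≤ ν⁻¹ * ‖u - v‖ := by
    intro x y u hu v hv
    have h1 := (hDν _ _ _ hu _ hv).trans (real_inner_le_norm _ _)
    rw [← div_eq_inv_mul, le_div_iff₀ hν]
    rcases (norm_nonneg (x - y)).eq_or_lt with h | h
    · rw [← h, zero_mul]; exact norm_nonneg _
    · refine le_of_mul_le_mul_left ?_ h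
      linarith [h1]
  refine ⟨T, ⟨ν⁻¹.toNNReal, LipschitzWith.of_dist_le_mul fun u v => ?_⟩, fun x u => ⟨fun h => ?_, ?_⟩⟩
  · rw [dist_eq_norm, dist_eq_norm, Real.coe_toNNReal _ (inv_pos.2 hν).le]
    exact hbound _ _ _ (hT u) _ (hT v)
  · have := hbound _ _ _ h _ (hT u)
    rw [sub_self, norm_zero, mul_zero] at this
    exact sub_eq_zero.1 (norm_le_zero_iff.1 this)
  · rintro rfl; exact hT u

/-- `D⁻¹` is a monotone Lipschitz map, so `B⁻¹ + D⁻¹` is maximally monotone, and inversion preserves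
this. -/
theorem IsMaximallyMonotone.parSum [CompleteSpace E] {B D : E → Set E}
    (hB : IsMaximallyMonotone B) (hD : IsMaximallyMonotone D) {ν : ℝ} (hν : 0 < ν)
    (hDν : IsStronglyMonotone ν D) : IsMaximallyMonotone (parSum B D) := by
  obtain ⟨T, ⟨k, hk⟩, hT⟩ := hD.exists_lipschitz_inverse hν hDν
  have h := (hB.invOp.add_lipschitz hk fun u v => by
    rw [real_inner_comm]
    exact hD.1 _ _ _ ((hT _ u).2 rfl) _ ((hT _ v).2 rfl)).invOp
  convert h using 1
  funext x
  ext u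
  rw [mem_parSum]
  simp only [MonotoneInclusion.invOp, Set.mem_ofPred_eq]
  constructor
  · rintro ⟨b, d, hb, hd, rfl⟩
    rw [← (hT d u).1 hd]; simpa using hb
  · intro hu
    exact ⟨x - T u, T u, hu, (hT _ u).2 rfl, by abel⟩

end Minty

/-! ### Maximality of `A + L* C L` by Yosida regularization. -/

section Composite

/-- The projection on the first factor of the domain of the Fitzpatrick function of `A`. -/
def fitzpatrickDom {E : Type*} [NormedAddCommGroup E] [InnerProductSpace ℝ E] (A : E → Set E) :
    Set E :=
  {x | ∃ (u : E) (c : ℝ), ∀ a, ∀ q ∈ A a, inner ℝ (x - a) q + inner ℝ a u ≤ c}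

theorem IsMonotone.domOp_subset_fitzpatrickDom {E : Type*} [NormedAddCommGroup E]
    [InnerProductSpace ℝ E] {A : E → Set E} (hA : IsMonotone A) :
    domOp A ⊆ fitzpatrickDom A := by
  rintro x ⟨u, hu⟩
  refine ⟨u, inner ℝ x u, fun a q hq => ?_⟩
  have := hA _ _ _ hu _ hq
  simp only [inner_sub_left, inner_sub_right] at this ⊢
  linarith

/-- A bounded sequence such that `⟪lₙ vₙ - lₖ vₖ, vₙ - vₖ⟫ ≤ 0`, where `lₙ` is positive and
antitone, converges. -/
theorem cauchySeq_of_inner_smul_sub_nonpos {E : Type*} [NormedAddCommGroup E]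
    [InnerProductSpace ℝ E] {v : ℕ → E} {l : ℕ → ℝ} (hl : ∀ n, 0 < l n) (hanti : Antitone l)
    (hv : ∀ n k, inner ℝ (l n • v n - l k • v k) (v n - v k) ≤ 0) {R : ℝ}
    (hR : ∀ n, ‖v n‖ ≤ R) : CauchySeq v := by
  -- Twice the inner product in `hv` equals `(lₙ + lₖ) ‖vₙ - vₖ‖² + (lₙ - lₖ) (‖vₙ‖² - ‖vₖ‖²)`.
  have key : ∀ n k, (l n + l k) * ‖v n - v k‖ ^ 2 ≤ (l n - l k) * (‖v k‖ ^ 2 - ‖v n‖ ^ 2) := by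
    intro n k
    have h := hv n k
    rw [norm_sub_sq_real]
    simp only [inner_sub_left, inner_sub_right, inner_smul_left, real_inner_self_eq_norm_sq,
      RCLike.conj_to_real] at h
    rw [real_inner_comm (v n) (v k)] at h
    linarith
  -- Since `lₙ - lₖ ≤ lₙ + lₖ`, the weights can be dropped; if they coincide, `key` gives `vₙ = vₖ`.
  -- Hence the squared norms increase, and their convergence controls the distances.
  have hle : ∀ n k, n ≤ k → ‖v n - v k‖ ^ 2 ≤ ‖v k‖ ^ 2 - ‖v n‖ ^ 2 := by
    intro n k hnk
    have h := key n k
    have h1 := hanti hnk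
    have h2 := hl k
    have h3 := sq_nonneg ‖v n - v k‖
    have h4 := hl n
    rcases h1.eq_or_lt with h5 | h5
    · rw [h5, sub_self, zero_mul] at h
      have h6 : ‖v n - v k‖ ^ 2 = 0 := by nlinarith
      have h7 : v n = v k :=
        sub_eq_zero.1 (norm_eq_zero.1 (pow_eq_zero_iff two_ne_zero |>.1 h6))
      simp [h7]
    · refine le_of_mul_le_mul_left (le_trans ?_ h) (sub_pos.2 h5)
      nlinarith
  have hmono : Monotone fun n => ‖v n‖ ^ 2 := fun n k hnk => by
    have := hle n k hnk
    have := sq_nonneg ‖v n - v k‖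
    simp only
    linarith
  have hbdd : BddAbove (Set.range fun n => ‖v n‖ ^ 2) := by
    refine ⟨R ^ 2, ?_⟩
    rintro _ ⟨n, rfl⟩
    exact pow_le_pow_left₀ (norm_nonneg _) (hR n) 2
  have hc := (tendsto_atTop_ciSup hmono hbdd).cauchySeq
  rw [Metric.cauchySeq_iff'] at hc ⊢
  intro ε hε
  obtain ⟨N, hN⟩ := hc (ε ^ 2) (by positivity)
  refine ⟨N, fun n hn => ?_⟩
  have h1 := hN n hn
  rw [Real.dist_eq] at h1
  have h2 := hle N n hn
  rw [dist_comm, dist_eq_norm]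
  exact lt_of_pow_lt_pow_left₀ 2 hε.le (h2.trans_lt ((le_abs_self _).trans_lt h1))

/-- Limits of graph points of a maximally monotone operator are in the graph. -/
theorem IsMaximallyMonotone.mem_of_tendsto {H : Type*} [NormedAddCommGroup H]
    [InnerProductSpace ℝ H] {A : H → Set H} (hA : IsMaximallyMonotone A)
    {x u : ℕ → H} {x₀ u₀ : H} (h : ∀ n, u n ∈ A (x n)) (hx : Tendsto x atTop (𝓝 x₀))
    (hu : Tendsto u atTop (𝓝 u₀)) : u₀ ∈ A x₀ :=
  hA.mem_of_forall fun a b hb =>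
    ge_of_tendsto' ((hx.sub_const a).inner (hu.sub_const b)) fun n => hA.1 _ _ _ (h n) _ hb

variable {H K : Type*} [NormedAddCommGroup H] [InnerProductSpace ℝ H] [CompleteSpace H]
  [NormedAddCommGroup K] [InnerProductSpace ℝ K] [CompleteSpace K]

/-- Solutions of the inclusion in which `C` is replaced by its Yosida approximation of
index `l`. -/
theorem exists_yosida_solution {A : H → Set H} (hA : IsMaximallyMonotone A) {C : K → Set K}
    (hC : IsMaximallyMonotone C) (L : H →L[ℝ] K) {l : ℝ} (hl : 0 < l) (z : H) :
    ∃ x v, z - x - ContinuousLinearMap.adjoint L v ∈ A x ∧ v ∈ C (L x - l • v) := by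
  -- `J` is the resolvent of `l C` and `U` its Yosida approximation, which is cocoercive, hence
  -- monotone and `l⁻¹`-Lipschitz. So `A + L* U L` is maximally monotone and Minty's theorem
  -- applies.
  choose J U hU hJ using fun y => hC.exists_add_smul_eq hl y
  have hUJ : ∀ y y', l * ‖U y - U y'‖ ^ 2 ≤ inner ℝ (y - y') (U y - U y') := by
    intro y y'
    have h := hC.1 _ _ _ (hU y) _ (hU y')
    have e : y - y' = J y - J y' + l • (U y - U y') := by
      conv_lhs => rw [← hJ y, ← hJ y']
      module
    rw [e, inner_add_left, inner_smul_left, real_inner_self_eq_norm_sq, RCLike.conj_to_real]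
    linarith
  have hUlip : LipschitzWith l⁻¹.toNNReal U := LipschitzWith.of_dist_le_mul fun y y' => by
    rw [dist_eq_norm, dist_eq_norm, Real.coe_toNNReal _ (inv_pos.2 hl).le, ← div_eq_inv_mul,
      le_div_iff₀ hl]
    have h := (hUJ y y').trans (real_inner_le_norm _ _)
    rcases (norm_nonneg (U y - U y')).eq_or_lt with h' | h'
    · rw [← h', zero_mul]; exact norm_nonneg _
    · refine le_of_mul_le_mul_right ?_ h'
      linarith
  have hT := ((ContinuousLinearMap.adjoint L).lipschitz.comp hUlip).comp L.lipschitz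
  have hmax := hA.add_lipschitz hT fun x y => by
    simp only [Function.comp_apply]
    rw [← map_sub, ContinuousLinearMap.adjoint_inner_right, map_sub]
    exact (mul_nonneg hl.le (sq_nonneg _)).trans (hUJ _ _)
  obtain ⟨x, u, hu, hxu⟩ := hmax.exists_add_smul_eq one_pos z
  rw [one_smul] at hxu
  refine ⟨x, U (L x), ?_, ?_⟩
  · rw [← hxu, add_sub_cancel_left]; exact hu
  · have h := hU (L x)
    rwa [eq_sub_of_add_eq (hJ (L x))] at h

/-- Adding the Fitzpatrick bounds for `A` at `a` and `C` at `c` cancels `⟪L x, v⟫`, leaving `⟪c - L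
a, v⟫ + ‖x‖² + l ‖v‖²` plus terms linear in `x` and in `l v`. The squares absorb these, so the bound
is uniform in `l ≤ 1`. -/
theorem exists_forall_inner_sub_le {A : H → Set H} {C : K → Set K} (L : H →L[ℝ] K) (z : H)
    {a : H} (ha : a ∈ fitzpatrickDom A) {c : K} (hc : c ∈ fitzpatrickDom C) :
    ∃ R : ℝ, ∀ (l : ℝ) (x : H) (v : K), 0 < l → l ≤ 1 →
      z - x - ContinuousLinearMap.adjoint L v ∈ A x → v ∈ C (L x - l • v) →
      inner ℝ (c - L a) v ≤ R := by
  obtain ⟨u', c₁, h₁⟩ := ha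
  obtain ⟨v', c₂, h₂⟩ := hc
  -- The vector that collects all terms linear in `x`.
  set q := z + a - u' - ContinuousLinearMap.adjoint L v' with hq
  refine ⟨c₁ + c₂ + ‖v'‖ ^ 2 + ‖q‖ ^ 2 - inner ℝ a z, fun l x v hl hl1 hx hv => ?_⟩
  have hA := h₁ _ _ hx
  have hC := h₂ _ _ hv
  have e1 : inner ℝ (x - a) (ContinuousLinearMap.adjoint L v) = inner ℝ (L x - L a) v := by
    rw [ContinuousLinearMap.adjoint_inner_right, map_sub]
  have e2 : inner ℝ x (ContinuousLinearMap.adjoint L v') = inner ℝ (L x) v' := by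
    rw [ContinuousLinearMap.adjoint_inner_right]
  have h3 : inner ℝ x q ≤ ‖x‖ ^ 2 + ‖q‖ ^ 2 := by
    have := real_inner_le_norm x q
    nlinarith [sq_nonneg (‖x‖ - ‖q‖), sq_nonneg ‖x‖, sq_nonneg ‖q‖]
  have h4 : l * inner ℝ v v' ≤ l * ‖v‖ ^ 2 + ‖v'‖ ^ 2 := by
    have h5 : inner ℝ v v' ≤ ‖v‖ ^ 2 + ‖v'‖ ^ 2 := by
      have := real_inner_le_norm v v'
      nlinarith [sq_nonneg (‖v‖ - ‖v'‖), sq_nonneg ‖v‖, sq_nonneg ‖v'‖]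
    have h6 := mul_le_mul_of_nonneg_left h5 hl.le
    have h7 := mul_le_mul_of_nonneg_right hl1 (sq_nonneg ‖v'‖)
    linarith
  simp only [hq, inner_sub_left, inner_sub_right, inner_add_right, inner_smul_left,
    real_inner_self_eq_norm_sq, RCLike.conj_to_real] at *
  rw [real_inner_comm a x] at h3
  linarith [real_inner_comm a x]

/-- Banach-Steinhaus for sequences in a closed subspace of a Hilbert space. -/
theorem exists_forall_norm_le_of_inner_bounded {S : Submodule ℝ K} (hS : IsClosed (S : Set K))
    {v : ℕ → K} (hv : ∀ n, v n ∈ S)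
    (hb : ∀ w ∈ S, ∃ R : ℝ, ∀ n, inner ℝ w (v n) ≤ R) : ∃ R : ℝ, ∀ n, ‖v n‖ ≤ R := by
  have : CompleteSpace S := hS.completeSpace_coe
  obtain ⟨R, hR⟩ := banach_steinhaus (g := fun n => innerSL ℝ (⟨v n, hv n⟩ : S)) fun w => by
    obtain ⟨R₁, h₁⟩ := hb w w.2
    obtain ⟨R₂, h₂⟩ := hb (-w) (S.neg_mem w.2)
    refine ⟨max R₁ R₂, fun n => ?_⟩
    rw [innerSL_apply_apply, Submodule.coe_inner, Real.norm_eq_abs, real_inner_comm]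
    refine abs_le.2 ⟨?_, (h₁ n).trans (le_max_left _ _)⟩
    have := (h₂ n).trans (le_max_right R₁ R₂)
    rw [inner_neg_left] at this
    linarith
  refine ⟨R, fun n => ?_⟩
  have := hR n
  rwa [innerSL_apply_norm] at this

theorem IsMonotone.add_adjoint_comp {A : H → Set H} (hA : IsMonotone A) {C : K → Set K}
    (hC : IsMonotone C) (L : H →L[ℝ] K) :
    IsMonotone fun x => {w | ∃ u ∈ A x, ∃ v ∈ C (L x), u + ContinuousLinearMap.adjoint L v = w} := by
  rintro x y _ ⟨u, hu, v, hv, rfl⟩ _ ⟨u', hu', v', hv', rfl⟩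
  have h1 := hA _ _ _ hu _ hu'
  have h2 := hC _ _ _ hv _ hv'
  have e : u + ContinuousLinearMap.adjoint L v - (u' + ContinuousLinearMap.adjoint L v') =
      (u - u') + ContinuousLinearMap.adjoint L (v - v') := by rw [map_sub]; abel
  rw [e, inner_add_right, ContinuousLinearMap.adjoint_inner_right, map_sub]
  exact add_nonneg h1 h2

/-- Maximal monotonicity of `A + L* C L` under a closed subspace qualification condition. -/
theorem IsMaximallyMonotone.add_adjoint_comp {A : H → Set H} (hA : IsMaximallyMonotone A)
    {C : K → Set K} (hC : IsMaximallyMonotone C) (L : H →L[ℝ] K) {Q : Set K}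
    (hQ : IsClosedSubspace (coneHull Q))
    (hQP : ∀ w ∈ Q, ∃ a ∈ fitzpatrickDom A, ∃ c ∈ fitzpatrickDom C, w = L a - c)
    (hdom : ∀ a ∈ domOp A, ∀ c ∈ domOp C, L a - c ∈ coneHull Q) :
    IsMaximallyMonotone fun x =>
      {w | ∃ u ∈ A x, ∃ v ∈ C (L x), u + ContinuousLinearMap.adjoint L v = w} := by
  obtain ⟨S, hS, hSQ⟩ := hQ
  refine (hA.1.add_adjoint_comp hC.1 L).isMaximallyMonotone_of_surjective one_pos fun z => ?_
  let l : ℕ → ℝ := fun n => 1 / ((n : ℝ) + 1)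
  have hl : ∀ n, 0 < l n := fun n => by positivity
  have hl1 : ∀ n, l n ≤ 1 := fun n => by
    rw [div_le_one (by positivity)]; linarith [n.cast_nonneg (α := ℝ)]
  have hanti : Antitone l := fun n k hnk => by
    simp only [l]; gcongr
  have hl0 : Tendsto l atTop (𝓝 0) := tendsto_one_div_add_atTop_nhds_zero_nat
  choose x v hx hv using fun n => exists_yosida_solution hA hC L (hl n) z
  -- The vector `lₙ vₙ` is the difference of `L xₙ` and a point of `dom C`, so it lies in the cone,
  -- which is the subspace `S`.
  have hvS : ∀ n, v n ∈ S := fun n => by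
    have h : L (x n) - (L (x n) - l n • v n) ∈ (S : Set K) := by
      rw [hSQ]; exact hdom _ ⟨_, hx n⟩ _ ⟨_, hv n⟩
    rw [sub_sub_cancel] at h
    exact (S.smul_mem_iff (hl n).ne').1 h
  -- Because the cone is a subspace, it contains `-w`, so `w` is a positive multiple of some `c - L
  -- a` with `a` and `c` in the Fitzpatrick domains.
  obtain ⟨R, hR⟩ := exists_forall_norm_le_of_inner_bounded hS hvS fun w hw => by
    have hw' : -w ∈ (S : Set K) := S.neg_mem hw
    rw [hSQ] at hw'
    obtain ⟨t, ht, w', hw'Q, hww'⟩ := hw'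
    obtain ⟨a, ha, c, hc, rfl⟩ := hQP w' hw'Q
    obtain ⟨R, hR⟩ := exists_forall_inner_sub_le L z ha hc
    refine ⟨t * R, fun n => ?_⟩
    have e : w = t • (c - L a) := by
      rw [← neg_inj, hww', ← smul_neg, neg_sub]
    rw [e, inner_smul_left, RCLike.conj_to_real]
    exact mul_le_mul_of_nonneg_left (hR _ _ _ (hl n) (hl1 n) (hx n) (hv n)) ht.le
  -- The monotonicity inequalities for `A` and `C` are added. This one estimate supplies the sign
  -- condition that makes `v` Cauchy and, with `‖vₙ‖ ≤ R` and `lₙ → 0`, makes `x` Cauchy.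
  have hkey : ∀ n k, ‖x n - x k‖ ^ 2 ≤ - inner ℝ (l n • v n - l k • v k) (v n - v k) := by
    intro n k
    have h1 := hA.1 _ _ _ (hx n) _ (hx k)
    have h2 := hC.1 _ _ _ (hv n) _ (hv k)
    have e1 : z - x n - ContinuousLinearMap.adjoint L (v n) -
        (z - x k - ContinuousLinearMap.adjoint L (v k)) =
        -(x n - x k) - ContinuousLinearMap.adjoint L (v n - v k) := by rw [map_sub]; abel
    have e2 : L (x n) - l n • v n - (L (x k) - l k • v k) =
        L (x n - x k) - (l n • v n - l k • v k) := by rw [map_sub]; abel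
    rw [e1, inner_sub_right, inner_neg_right, real_inner_self_eq_norm_sq,
      ContinuousLinearMap.adjoint_inner_right] at h1
    rw [e2, inner_sub_left] at h2
    linarith
  have hvc : CauchySeq v := cauchySeq_of_inner_smul_sub_nonpos hl hanti
    (fun n k => by have := hkey n k; have := sq_nonneg ‖x n - x k‖; linarith) hR
  have hR0 : 0 ≤ R := (norm_nonneg _).trans (hR 0)
  have hxb : ∀ n k, ‖x n - x k‖ ^ 2 ≤ (l n + l k) * (2 * R ^ 2) := by
    intro n k
    refine (hkey n k).trans ((neg_le_abs _).trans ((abs_real_inner_le_norm _ _).trans ?_))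
    have h1 : ‖l n • v n - l k • v k‖ ≤ (l n + l k) * R := by
      refine (norm_sub_le _ _).trans ?_
      rw [norm_smul, norm_smul, Real.norm_of_nonneg (hl n).le, Real.norm_of_nonneg (hl k).le,
        add_mul]
      exact add_le_add (mul_le_mul_of_nonneg_left (hR n) (hl n).le)
        (mul_le_mul_of_nonneg_left (hR k) (hl k).le)
    have h2 : ‖v n - v k‖ ≤ 2 * R := (norm_sub_le _ _).trans (by linarith [hR n, hR k])
    refine (mul_le_mul h1 h2 (norm_nonneg _)
      (mul_nonneg (add_pos (hl n) (hl k)).le hR0)).trans (le_of_eq (by ring))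
  have hxc : CauchySeq x := by
    rw [Metric.cauchySeq_iff]
    intro ε hε
    have hlim : Tendsto (fun n => l n * (4 * R ^ 2)) atTop (𝓝 0) := by
      simpa using hl0.mul_const (4 * R ^ 2)
    obtain ⟨N, hN⟩ := (hlim.eventually
      (gt_mem_nhds (show 0 < ε ^ 2 by positivity))).exists_forall_of_atTop
    refine ⟨N, fun n hn k hk => ?_⟩
    rw [dist_eq_norm]
    refine lt_of_pow_lt_pow_left₀ 2 hε.le ?_
    linarith [hxb n k, hN n hn, hN k hk]
  obtain ⟨x₀, hx₀⟩ := cauchySeq_tendsto_of_complete hxc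
  obtain ⟨v₀, hv₀⟩ := cauchySeq_tendsto_of_complete hvc
  have hu₀ : Tendsto (fun n => z - x n - ContinuousLinearMap.adjoint L (v n)) atTop
      (𝓝 (z - x₀ - ContinuousLinearMap.adjoint L v₀)) :=
    (hx₀.const_sub z).sub (((ContinuousLinearMap.adjoint L).continuous.tendsto _).comp hv₀)
  have hy₀ : Tendsto (fun n => L (x n) - l n • v n) atTop (𝓝 (L x₀)) := by
    simpa using ((L.continuous.tendsto _).comp hx₀).sub (hl0.smul hv₀)
  refine ⟨x₀, _, ⟨_, hA.mem_of_tendsto hx hx₀ hu₀, v₀, hC.mem_of_tendsto hv hy₀ hv₀, rfl⟩, ?_⟩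
  rw [one_smul]; abel

end Composite

/-! ### Subdifferentials, Fitzpatrick bounds and relative interiors. -/

section Convex

variable {E : Type*} [NormedAddCommGroup E] [InnerProductSpace ℝ E]

theorem IsGammaZero.convex_effDom {f : E → EReal} (hf : IsGammaZero f) :
    Convex ℝ (effDom f) := by
  rw [convex_iff_forall_pos]
  intro x hx y hy a b ha hb hab
  refine (hf.convex x y a b ha hb hab).trans_lt ?_
  have hx' : f x ≠ ⊤ := ne_of_lt hx
  have hy' : f y ≠ ⊤ := ne_of_lt hy
  rw [← EReal.coe_toReal hx' (hf.ne_bot x), ← EReal.coe_toReal hy' (hf.ne_bot y)]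
  exact_mod_cast EReal.coe_lt_top _

theorem IsGammaZero.domOp_subdiff_subset {f : E → EReal} (hf : IsGammaZero f) :
    domOp (subdiff f) ⊆ effDom f := by
  rintro x ⟨u, hu⟩
  obtain ⟨y, hy⟩ := hf.nonempty
  by_contra h
  have hx : f x = ⊤ := not_lt_top_iff.1 h
  have := hu y
  rw [hx, EReal.coe_add_top, top_le_iff] at this
  exact (ne_of_lt hy) this

theorem IsGammaZero.exists_toReal_subdiff {f : E → EReal} (hf : IsGammaZero f) {x u : E}
    (hu : u ∈ subdiff f x) {y : E} (hy : y ∈ effDom f) :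
    inner ℝ (y - x) u + (f x).toReal ≤ (f y).toReal := by
  have h := hu y
  have hx : f x ≠ ⊤ := ne_of_lt (hf.domOp_subdiff_subset ⟨u, hu⟩)
  rw [← EReal.coe_toReal hx (hf.ne_bot x), ← EReal.coe_toReal (ne_of_lt hy) (hf.ne_bot y)] at h
  exact_mod_cast h

/-- The Fitzpatrick function of `∂f` is finite at `(x, u)` for `x ∈ dom f` and `u ∈ ran ∂f`. -/
theorem IsGammaZero.exists_fitzpatrick_le {f : E → EReal} (hf : IsGammaZero f) {x : E}
    (hx : x ∈ effDom f) {u a₀ : E} (hu : u ∈ subdiff f a₀) :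
    ∃ c : ℝ, ∀ a, ∀ q ∈ subdiff f a, inner ℝ (x - a) q + inner ℝ a u ≤ c := by
  refine ⟨(f x).toReal - (f a₀).toReal + inner ℝ a₀ u, fun a q hq => ?_⟩
  have h1 := hf.exists_toReal_subdiff hq hx
  have h2 := hf.exists_toReal_subdiff hu (hf.domOp_subdiff_subset ⟨q, hq⟩)
  rw [inner_sub_left] at h2
  linarith

/-- The line through `c` and `x` stays in the affine span of `C`, in which `C` is a neighbourhood of
`x`; segments can thus be prolonged beyond `x`. -/
theorem eventually_add_smul_sub_mem_of_mem_intrinsicInterior {C : Set E} {x c : E}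
    (hx : x ∈ intrinsicInterior ℝ C) (hc : c ∈ C) :
    ∀ᶠ t : ℝ in 𝓝[>] 0, x + t • (x - c) ∈ C := by
  obtain ⟨y, hy, rfl⟩ := mem_intrinsicInterior.1 hx
  have hmem : ∀ t : ℝ, (y : E) + t • ((y : E) - c) ∈ affineSpan ℝ C := fun t => by
    have := AffineMap.lineMap_mem (-t) y.2 (subset_affineSpan ℝ C hc)
    rw [AffineMap.lineMap_apply_module'] at this
    convert this using 1
    module
  have hcont : Continuous fun t : ℝ => (⟨_, hmem t⟩ : affineSpan ℝ C) :=
    Continuous.subtype_mk (by fun_prop) _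
  have h0 : (⟨_, hmem 0⟩ : affineSpan ℝ C) = y := Subtype.ext (by simp)
  have hnhds : ((↑) : affineSpan ℝ C → E) ⁻¹' C ∈ 𝓝 (⟨_, hmem 0⟩ : affineSpan ℝ C) := by
    rw [h0]; exact mem_interior_iff_mem_nhds.1 hy
  exact nhdsWithin_le_nhds (hcont.continuousAt.preimage_mem_nhds hnhds)

/-- Prolonging segments beyond `x` makes the cone of `C - x` symmetric, convexity makes it closed
under addition, and finite dimension makes the resulting subspace closed. -/
theorem mem_sri_of_convex [FiniteDimensional ℝ E] {C : Set E} (hC : Convex ℝ C) {x : E}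
    (hx : x ∈ C) (h : ∀ c ∈ C, ∃ t : ℝ, 0 < t ∧ x + t • (x - c) ∈ C) : x ∈ sri C := by
  set Q := (fun c => -x + c) '' C with hQdef
  have hQ : Convex ℝ Q := by
    have := hC.translate (-x)
    simpa [Q] using this
  have h0 : (0 : E) ∈ coneHull Q := ⟨1, one_pos, 0, ⟨x, hx, by simp⟩, by simp⟩
  have hneg : ∀ w ∈ coneHull Q, -w ∈ coneHull Q := by
    rintro _ ⟨s, hs, _, ⟨c, hc, rfl⟩, rfl⟩
    obtain ⟨t, ht, hmem⟩ := h c hc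
    refine ⟨s / t, div_pos hs ht, _, ⟨_, hmem, rfl⟩, ?_⟩
    simp only [neg_add_cancel_left, smul_smul, div_mul_cancel₀ _ ht.ne', ← smul_neg]
    congr 1
    abel
  have hpos : ∀ t : ℝ, 0 < t → ∀ w ∈ coneHull Q, t • w ∈ coneHull Q := by
    rintro t ht _ ⟨s, hs, q, hq, rfl⟩
    exact ⟨t * s, mul_pos ht hs, q, hq, smul_smul _ _ _⟩
  refine ⟨hx, ⟨⟨⟨⟨coneHull Q, ?_⟩, h0⟩, ?_⟩, Submodule.closed_of_finiteDimensional _, rfl⟩⟩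
  · rintro _ _ ⟨s, hs, p, hp, rfl⟩ ⟨t, ht, q, hq, rfl⟩
    have hst : 0 < s + t := add_pos hs ht
    refine ⟨s + t, hst, _, hQ hp hq (div_pos hs hst).le (div_pos ht hst).le ?_, ?_⟩
    · rw [← add_div, div_self hst.ne']
    · rw [smul_add, smul_smul, smul_smul, mul_div_cancel₀ _ hst.ne', mul_div_cancel₀ _ hst.ne']
  · intro t w hw
    rcases lt_trichotomy t 0 with ht | rfl | ht
    · have := hpos (-t) (neg_pos.2 ht) _ (hneg _ hw)
      rwa [smul_neg, neg_smul, neg_neg] at this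
    · rw [zero_smul]; exact h0
    · exact hpos t ht _ hw

end Convex

/-! ### The combined operator into the Hilbert direct sum. -/

section Product

/-- The bounded operator `x ↦ (Lᵢ x)ᵢ` into the Hilbert direct sum. -/
noncomputable def toPiLp {H : Type*} [NormedAddCommGroup H] [InnerProductSpace ℝ H] {m : ℕ}
    {G : Fin m → Type*} [∀ i, NormedAddCommGroup (G i)] [∀ i, InnerProductSpace ℝ (G i)]
    (L : ∀ i, H →L[ℝ] G i) : H →L[ℝ] PiLp 2 G :=
  (PiLp.continuousLinearEquiv 2 ℝ G).symm.toContinuousLinearMap ∘L ContinuousLinearMap.pi L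

@[simp] theorem toPiLp_apply {H : Type*} [NormedAddCommGroup H] [InnerProductSpace ℝ H] {m : ℕ}
    {G : Fin m → Type*} [∀ i, NormedAddCommGroup (G i)] [∀ i, InnerProductSpace ℝ (G i)]
    (L : ∀ i, H →L[ℝ] G i) (x : H) (i : Fin m) : toPiLp L x i = L i x := rfl

variable {H : Type*} [NormedAddCommGroup H] [InnerProductSpace ℝ H] [CompleteSpace H]
  {m : ℕ} {G : Fin m → Type*} [∀ i, NormedAddCommGroup (G i)]
  [∀ i, InnerProductSpace ℝ (G i)] [∀ i, CompleteSpace (G i)]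

theorem adjoint_toPiLp (L : ∀ i, H →L[ℝ] G i) (v : PiLp 2 G) :
    ContinuousLinearMap.adjoint (toPiLp L) v = ∑ i, ContinuousLinearMap.adjoint (L i) (v i) := by
  refine ext_inner_left ℝ fun x => ?_
  rw [ContinuousLinearMap.adjoint_inner_right, PiLp.inner_apply, inner_sum]
  simp only [toPiLp_apply, ContinuousLinearMap.adjoint_inner_right]

end Product

/-! ### Resolvents and ranges as membership `z - ρ x ∈ A x`. -/

section Membership

variable {E : Type*} [NormedAddCommGroup E] [InnerProductSpace ℝ E]

theorem mem_resolventOp_smul_iff {A : E → Set E} {ρ : ℝ} (hρ : ρ ≠ 0) {x y : E} :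
    x ∈ resolventOp (ρ⁻¹ • A) (ρ⁻¹ • y) ↔ y - ρ • x ∈ A x := by
  simp only [resolventOp, invOp, idOp, Set.mem_ofPred_eq, Pi.add_apply, Pi.smul_apply,
    Set.singleton_add, Set.mem_image, Set.mem_smul_set]
  constructor
  · rintro ⟨_, ⟨u, hu, rfl⟩, h⟩
    have : y = ρ • x + u := by
      rw [← (smul_right_injective E (inv_ne_zero hρ)).eq_iff]
      simp only [smul_add, smul_smul, inv_mul_cancel₀ hρ, one_smul, h]
    rwa [this, add_sub_cancel_left]
  · intro h
    refine ⟨_, ⟨_, h, rfl⟩, ?_⟩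
    rw [smul_sub, smul_smul, inv_mul_cancel₀ hρ, one_smul, add_sub_cancel]

theorem mem_ranOp_add_smul_idOp_iff {A : E → Set E} {ρ : ℝ} {z : E} :
    z ∈ ranOp (A + ρ • idOp) ↔ ∃ x, z - ρ • x ∈ A x := by
  simp only [ranOp, idOp, Set.mem_ofPred_eq, Pi.add_apply, Pi.smul_apply, Set.smul_set_singleton,
    Set.add_singleton, Set.mem_image]
  refine exists_congr fun x => ⟨?_, fun h => ⟨_, h, sub_add_cancel _ _⟩⟩
  rintro ⟨u, hu, rfl⟩
  rwa [add_sub_cancel_right]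

theorem IsMonotone.eq_of_sub_smul_mem {A : E → Set E} (hA : IsMonotone A) {ρ : ℝ} (hρ : 0 < ρ)
    {x y z : E} (hx : z - ρ • x ∈ A x) (hy : z - ρ • y ∈ A y) : x = y := by
  have h := hA _ _ _ hx _ hy
  have e : z - ρ • x - (z - ρ • y) = -(ρ • (x - y)) := by module
  rw [e, inner_neg_right, inner_smul_right, real_inner_self_eq_norm_sq] at h
  have h2 : ‖x - y‖ ^ 2 = 0 := by
    have := sq_nonneg ‖x - y‖
    nlinarith
  exact sub_eq_zero.1 (norm_eq_zero.1 (pow_eq_zero_iff two_ne_zero |>.1 h2))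

theorem IsMonotone.isMaximallyMonotone_iff [CompleteSpace E] {A : E → Set E} (hA : IsMonotone A)
    {ρ : ℝ} (hρ : 0 < ρ) : IsMaximallyMonotone A ↔ ∀ z, ∃ x, z - ρ • x ∈ A x := by
  refine ⟨fun h z => ?_, fun h => hA.isMaximallyMonotone_of_surjective (inv_pos.2 hρ) fun z => ?_⟩
  · obtain ⟨x, u, hu, hxu⟩ := h.exists_add_smul_eq (inv_pos.2 hρ) (ρ⁻¹ • z)
    refine ⟨x, ?_⟩
    have : z = ρ • x + u := by
      rw [← (smul_right_injective E (inv_pos.2 hρ).ne').eq_iff]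
      simp only [smul_add, smul_smul, inv_mul_cancel₀ hρ.ne', one_smul, hxu]
    rwa [this, add_sub_cancel_left]
  · obtain ⟨x, hx⟩ := h (ρ • z)
    refine ⟨x, _, hx, ?_⟩
    rw [smul_sub, smul_smul, smul_smul, inv_mul_cancel₀ hρ.ne', one_smul, one_smul, add_sub_cancel]

end Membership

/-! ### The product of parallel sums and the qualification sets for functions. -/

section ProductSpace

variable {H : Type*} [NormedAddCommGroup H] [InnerProductSpace ℝ H]
  {m : ℕ} {G : Fin m → Type*} [∀ i, NormedAddCommGroup (G i)]
  [∀ i, InnerProductSpace ℝ (G i)]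

/-- The product operator `(yᵢ)ᵢ ↦ ∏ᵢ (Bᵢ □ Dᵢ) (yᵢ - rᵢ)`. -/
def piParSum (B D : ∀ i, G i → Set (G i)) (r : ∀ i, G i) : PiLp 2 G → Set (PiLp 2 G) :=
  fun y => {v | ∀ i, v i ∈ parSum (B i) (D i) (y i - r i)}

theorem mem_fitzpatrickDom_piParSum {B D : ∀ i, G i → Set (G i)} {r : ∀ i, G i} {y : PiLp 2 G}
    (h : ∀ i, y i - r i ∈ fitzpatrickDom (parSum (B i) (D i))) :
    y ∈ fitzpatrickDom (piParSum B D r) := by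
  choose u c hc using h
  refine ⟨WithLp.toLp 2 u, ∑ i, (c i + inner ℝ (r i) (u i)), fun a q hq => ?_⟩
  rw [PiLp.inner_apply, PiLp.inner_apply, ← Finset.sum_add_distrib]
  refine Finset.sum_le_sum fun i _ => ?_
  have := hc i _ _ (hq i)
  rw [sub_sub_sub_cancel_right, inner_sub_left (a i)] at this
  simp only [PiLp.sub_apply]
  linarith

/-- A subgradient `q` of the parallel sum at `b + d` is common to `g` at `b` and `l` at `d`, so the
Fitzpatrick expression splits into those of `∂g` and `∂l`. The vector `u` must be common to both
ranges. -/
theorem effDom_add_effDom_subset_fitzpatrickDom {E : Type*} [NormedAddCommGroup E]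
    [InnerProductSpace ℝ E] {g l : E → EReal} (hg : IsGammaZero g) (hl : IsGammaZero l) {u : E}
    (hug : u ∈ ranOp (subdiff g)) (hul : u ∈ ranOp (subdiff l)) :
    effDom g + effDom l ⊆ fitzpatrickDom (parSum (subdiff g) (subdiff l)) := by
  rintro _ ⟨y, hy, w, hw, rfl⟩
  obtain ⟨a₀, ha₀⟩ := hug
  obtain ⟨b₀, hb₀⟩ := hul
  obtain ⟨c₁, h₁⟩ := hg.exists_fitzpatrick_le hy ha₀
  obtain ⟨c₂, h₂⟩ := hl.exists_fitzpatrick_le hw hb₀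
  refine ⟨u, c₁ + c₂, fun a q hq => ?_⟩
  obtain ⟨b, d, hb, hd, rfl⟩ := mem_parSum.1 hq
  have := h₁ b q hb
  have := h₂ d q hd
  have e : y + w - (b + d) = (y - b) + (w - d) := by abel
  simp only [e, inner_add_left]
  linarith

theorem IsRealValued.mem_effDom {E : Type*} {k : E → EReal}
    (hk : IsRealValued k) (x : E) : x ∈ effDom k := by
  obtain ⟨t, ht⟩ := hk x
  change k x < ⊤
  rw [ht]
  exact EReal.coe_lt_top t

/-- One full effective domain makes each `dom gᵢ + dom ℓᵢ`, and so the qualification set, the whole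
space. -/
theorem mem_sri_qualSetFun_of_isRealValued {f : H → EReal} {g l : ∀ i, G i → EReal}
    (hf : IsGammaZero f) (hg : ∀ i, IsGammaZero (g i)) (hl : ∀ i, IsGammaZero (l i))
    (L : ∀ i, H →L[ℝ] G i) (h : ∀ i, IsRealValued (g i) ∨ IsRealValued (l i)) (r : PiLp 2 G) :
    r ∈ sri (qualSetFun f g l L) := by
  have hsum : ∀ i, effDom (g i) + effDom (l i) = Set.univ := fun i => by
    obtain ⟨a, ha⟩ := (hg i).nonempty
    obtain ⟨b, hb⟩ := (hl i).nonempty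
    refine Set.eq_univ_of_forall fun y => ?_
    rcases h i with h | h
    · exact ⟨y - b, h.mem_effDom _, b, hb, sub_add_cancel _ _⟩
    · exact ⟨a, ha, y - a, h.mem_effDom _, add_sub_cancel _ _⟩
  have huniv : qualSetFun f g l L = Set.univ := Set.eq_univ_of_forall fun w => by
    obtain ⟨x, hx⟩ := hf.nonempty
    exact ⟨x, hx, fun i => L i x - w i, fun i => by rw [hsum]; trivial, fun i => by simp⟩
  have hcone : (Set.univ : Set (PiLp 2 G)) = coneHull ((fun c => -r + c) '' qualSetFun f g l L) := by
    rw [huniv]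
    refine (Set.eq_univ_of_forall fun w => ?_).symm
    exact ⟨1, one_pos, w, ⟨r + w, trivial, by simp⟩, by simp⟩
  exact ⟨by rw [huniv]; trivial, ⊤, isClosed_univ, hcone⟩

theorem convex_qualSetFun {f : H → EReal} {g l : ∀ i, G i → EReal}
    (hf : IsGammaZero f) (hg : ∀ i, IsGammaZero (g i)) (hl : ∀ i, IsGammaZero (l i))
    (L : ∀ i, H →L[ℝ] G i) : Convex ℝ (qualSetFun f g l L) := by
  rintro w ⟨x, hx, y, hy, hw⟩ w' ⟨x', hx', y', hy', hw'⟩ s t hs ht hst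
  refine ⟨s • x + t • x', hf.convex_effDom hx hx' hs ht hst, fun i => s • y i + t • y' i,
    fun i => ((hg i).convex_effDom.add (hl i).convex_effDom) (hy i) (hy' i) hs ht hst,
    fun i => ?_⟩
  simp only [PiLp.add_apply, PiLp.smul_apply, hw i, hw' i, map_add, map_smul]
  module

theorem mem_sri_qualSetFun_of_mem_intrinsicInterior [∀ i, FiniteDimensional ℝ (G i)]
    {f : H → EReal} {g l : ∀ i, G i → EReal}
    (hf : IsGammaZero f) (hg : ∀ i, IsGammaZero (g i)) (hl : ∀ i, IsGammaZero (l i))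
    {L : ∀ i, H →L[ℝ] G i} {r : ∀ i, G i} {x : H} (hx : x ∈ intrinsicInterior ℝ (effDom f))
    (hxr : ∀ i, L i x - r i ∈
      intrinsicInterior ℝ (effDom (g i)) + intrinsicInterior ℝ (effDom (l i))) :
    WithLp.toLp 2 r ∈ sri (qualSetFun f g l L) := by
  choose p hp q hq hpq using hxr
  have hri : ∀ i, r i = L i x - (p i + q i) := fun i => by
    have : p i + q i = L i x - r i := hpq i
    rw [this, sub_sub_cancel]
  refine mem_sri_of_convex (convex_qualSetFun hf hg hl L) ⟨x, intrinsicInterior_subset hx,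
    fun i => p i + q i, fun i => ⟨_, intrinsicInterior_subset (hp i), _,
      intrinsicInterior_subset (hq i), rfl⟩, hri⟩ ?_
  rintro w ⟨x', hx', y, hy, hw⟩
  choose p' hp' q' hq' hpq' using hy
  -- There are finitely many prolongation conditions, so a single small `t` serves them all.
  have hev : ∀ᶠ t : ℝ in 𝓝[>] 0, 0 < t ∧ x + t • (x - x') ∈ effDom f ∧
      (∀ i, p i + t • (p i - p' i) ∈ effDom (g i)) ∧
      ∀ i, q i + t • (q i - q' i) ∈ effDom (l i) :=
    (eventually_mem_nhdsWithin (a := (0 : ℝ)) (s := Set.Ioi 0)).and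
      ((eventually_add_smul_sub_mem_of_mem_intrinsicInterior hx hx').and
      ((eventually_all.2 fun i =>
        eventually_add_smul_sub_mem_of_mem_intrinsicInterior (hp i) (hp' i)).and
      (eventually_all.2 fun i =>
        eventually_add_smul_sub_mem_of_mem_intrinsicInterior (hq i) (hq' i))))
  obtain ⟨t, ht, h1, h2, h3⟩ := hev.exists
  refine ⟨t, ht, _, h1, _, fun i => ⟨_, h2 i, _, h3 i, rfl⟩, fun i => ?_⟩
  have e : y i = p' i + q' i := (hpq' i).symm
  simp only [PiLp.add_apply, PiLp.smul_apply, PiLp.sub_apply, hw i, hri i, e, map_add, map_smul,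
    map_sub]
  module

end ProductSpace

/-! ### The composite operator: maximality, primal and dual solutions. -/

section CompositeOp

variable {H : Type*} [NormedAddCommGroup H] [InnerProductSpace ℝ H] [CompleteSpace H]
  {m : ℕ} {G : Fin m → Type*} [∀ i, NormedAddCommGroup (G i)]
  [∀ i, InnerProductSpace ℝ (G i)] [∀ i, CompleteSpace (G i)]

theorem mem_compositeOp_iff {A : H → Set H} {B D : ∀ i, G i → Set (G i)}
    {L : ∀ i, H →L[ℝ] G i} {r : ∀ i, G i} {x w : H} :
    w ∈ compositeOp A B D L r x ↔ ∃ u ∈ A x, ∃ v : ∀ i, G i,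
      (∀ i, v i ∈ parSum (B i) (D i) (L i x - r i)) ∧
        u + ∑ i, ContinuousLinearMap.adjoint (L i) (v i) = w := by
  simp only [compositeOp, Set.mem_add, Set.mem_fintype_sum]
  constructor
  · rintro ⟨u, hu, _, ⟨y, hy, rfl⟩, rfl⟩
    choose v hv hvy using hy
    exact ⟨u, hu, v, hv, by simp only [hvy]⟩
  · rintro ⟨u, hu, v, hv, rfl⟩
    exact ⟨u, hu, _, ⟨_, fun i => ⟨v i, hv i, rfl⟩, rfl⟩, rfl⟩

/-- Reduces the sum of `m` compositions to a single one, so that the result on `A + L* C L` applies.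
-/
theorem compositeOp_eq (A : H → Set H) (B D : ∀ i, G i → Set (G i))
    (L : ∀ i, H →L[ℝ] G i) (r : ∀ i, G i) :
    compositeOp A B D L r = fun x => {w | ∃ u ∈ A x, ∃ v ∈ piParSum B D r (toPiLp L x),
      u + ContinuousLinearMap.adjoint (toPiLp L) v = w} := by
  funext x
  ext w
  rw [mem_compositeOp_iff]
  simp only [Set.mem_ofPred_eq, adjoint_toPiLp]
  refine exists_congr fun u => and_congr_right fun _ => ⟨?_, ?_⟩
  · rintro ⟨v, hv, h⟩
    exact ⟨WithLp.toLp 2 v, hv, h⟩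
  · rintro ⟨v, hv, h⟩
    exact ⟨v, hv, h⟩

theorem isMaximallyMonotone_piParSum {B D : ∀ i, G i → Set (G i)}
    (h : ∀ i, IsMaximallyMonotone (parSum (B i) (D i))) (r : ∀ i, G i) :
    IsMaximallyMonotone (piParSum B D r) := by
  refine IsMonotone.isMaximallyMonotone_of_surjective (fun x y u hu v hv => ?_) one_pos fun z => ?_
  · rw [PiLp.inner_apply]
    refine Finset.sum_nonneg fun i _ => ?_
    have := (h i).1 _ _ _ (hu i) _ (hv i)
    rwa [sub_sub_sub_cancel_right] at this
  · choose x u hu hxu using fun i => (h i).exists_add_smul_eq one_pos (z i - r i)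
    refine ⟨WithLp.toLp 2 fun i => x i + r i, WithLp.toLp 2 u, fun i => ?_, ?_⟩
    · simpa using hu i
    · ext i
      have := hxu i
      rw [one_smul] at this
      simp only [one_smul, PiLp.add_apply]
      rw [add_right_comm, this, sub_add_cancel]

theorem isMonotone_compositeOp {A : H → Set H} (hA : IsMonotone A) {B D : ∀ i, G i → Set (G i)}
    (h : ∀ i, IsMaximallyMonotone (parSum (B i) (D i))) (L : ∀ i, H →L[ℝ] G i) (r : ∀ i, G i) :
    IsMonotone (compositeOp A B D L r) := by
  rw [compositeOp_eq]
  exact hA.add_adjoint_comp (isMaximallyMonotone_piParSum h r).1 _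

theorem isMaximallyMonotone_compositeOp_of_qualSet {A : H → Set H} (hA : IsMaximallyMonotone A)
    {B D : ∀ i, G i → Set (G i)} (h : ∀ i, IsMaximallyMonotone (parSum (B i) (D i)))
    {L : ∀ i, H →L[ℝ] G i} {r : ∀ i, G i}
    (hq : IsClosedSubspace (coneHull (qualSet A B D L r))) :
    IsMaximallyMonotone (compositeOp A B D L r) := by
  rw [compositeOp_eq]
  refine hA.add_adjoint_comp (isMaximallyMonotone_piParSum h r) _ hq ?_ ?_
  · rintro w ⟨x, hx, v, hv, hw⟩
    refine ⟨x, hA.1.domOp_subset_fitzpatrickDom hx, WithLp.toLp 2 fun i => r i + v i,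
      mem_fitzpatrickDom_piParSum fun i => (h i).1.domOp_subset_fitzpatrickDom ?_, ?_⟩
    · simp only [add_sub_cancel_left]
      exact hv i
    · ext i
      simp [hw i, sub_sub]
  · rintro a ha c ⟨v, hv⟩
    refine ⟨1, one_pos, _, ⟨a, ha, fun i => c i - r i, fun i => ⟨v i, hv i⟩, fun i => ?_⟩,
      (one_smul _ _).symm⟩
    simp

/-- The set `Q` is the qualification set translated by `-r`. It is built from effective domains,
which contain the domains of the subdifferentials and lie in the Fitzpatrick domains, as the general
criterion requires. -/
theorem isMaximallyMonotone_compositeOp_of_mem_sri {f : H → EReal} {g l : ∀ i, G i → EReal}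
    (hf : IsGammaZero f) (hA : IsMaximallyMonotone (subdiff f)) (hg : ∀ i, IsGammaZero (g i))
    (hl : ∀ i, IsGammaZero (l i))
    (h : ∀ i, IsMaximallyMonotone (parSum (subdiff (g i)) (subdiff (l i))))
    {L : ∀ i, H →L[ℝ] G i} {r : ∀ i, G i} (hr : WithLp.toLp 2 r ∈ sri (qualSetFun f g l L)) :
    IsMaximallyMonotone
      (compositeOp (subdiff f) (fun i => subdiff (g i)) (fun i => subdiff (l i)) L r) := by
  rw [compositeOp_eq]
  refine hA.add_adjoint_comp (isMaximallyMonotone_piParSum h r) _ hr.2 ?_ ?_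
  · rintro _ ⟨w, ⟨x, hx, y, hy, hw⟩, rfl⟩
    obtain ⟨a₀, u₀, hu₀⟩ := hA.exists_mem
    refine ⟨x, ⟨u₀, hf.exists_fitzpatrick_le hx hu₀⟩, WithLp.toLp 2 fun i => r i + y i,
      mem_fitzpatrickDom_piParSum fun i => ?_, ?_⟩
    · simp only [add_sub_cancel_left]
      -- Any graph point of the parallel sum provides a vector lying in both ranges.
      obtain ⟨p, u, hu⟩ := (h i).exists_mem
      obtain ⟨b, d, hb, hd, -⟩ := mem_parSum.1 hu
      exact effDom_add_effDom_subset_fitzpatrickDom (hg i) (hl i) ⟨b, hb⟩ ⟨d, hd⟩ (hy i)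
    · ext i
      simp only [PiLp.add_apply, PiLp.neg_apply, PiLp.sub_apply, toPiLp_apply, hw i]
      abel
  · rintro a ha c ⟨v, hv⟩
    refine ⟨1, one_pos, _, ⟨toPiLp L a - c + WithLp.toLp 2 r, ⟨a, hf.domOp_subdiff_subset ha,
      fun i => c i - r i, fun i => ?_, fun i => ?_⟩, rfl⟩, ?_⟩
    · obtain ⟨b, d, hb, hd, hbd⟩ := mem_parSum.1 (hv i)
      exact ⟨b, (hg i).domOp_subdiff_subset ⟨_, hb⟩, d, (hl i).domOp_subdiff_subset ⟨_, hd⟩, hbd⟩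
    · simp only [PiLp.add_apply, PiLp.sub_apply, toPiLp_apply]
      abel
    · simp only [one_smul]; abel

theorem isPrimalSolution_iff {ρ : ℝ} {A : H → Set H} {B D : ∀ i, G i → Set (G i)}
    {L : ∀ i, H →L[ℝ] G i} {r : ∀ i, G i} {z x : H} :
    IsPrimalSolution ρ A B D L r z x ↔ z - ρ • x ∈ compositeOp A B D L r x := by
  simp only [IsPrimalSolution, Set.add_singleton, Set.mem_image]
  refine ⟨?_, fun h => ⟨_, h, sub_add_cancel _ _⟩⟩
  rintro ⟨u, hu, rfl⟩
  rwa [add_sub_cancel_right]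

/-- The components `vᵢ` in a decomposition of `z - ρ x` form a dual solution: the remaining summand
lies in `A x`, which identifies `x` as the resolvent value. -/
theorem exists_isDualSolution {ρ : ℝ} (hρ : ρ ≠ 0) {A : H → Set H} {B D : ∀ i, G i → Set (G i)}
    {L : ∀ i, H →L[ℝ] G i} {r : ∀ i, G i} {z x : H}
    (hx : z - ρ • x ∈ compositeOp A B D L r x) : ∃ v, IsDualSolution ρ A B D L r z v := by
  obtain ⟨u, hu, v, hv, hz⟩ := mem_compositeOp_iff.1 hx
  refine ⟨v, fun i => ?_⟩
  obtain ⟨b, d, hb, hd, hbd⟩ := mem_parSum.1 (hv i)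
  refine ⟨_, ⟨_, ⟨x, (mem_resolventOp_smul_iff hρ).2 ?_, rfl⟩, b, hb, rfl⟩, d, hd, ?_⟩
  · rw [sub_right_comm, ← hz, add_sub_cancel_right]
    exact hu
  · change L i x - b - d = r i
    rw [sub_sub, hbd, sub_sub_cancel]

/-- Every dual solution produces a primal solution, as the value of a resolvent of `A`. -/
theorem IsDualSolution.exists_primal {ρ : ℝ} (hρ : 0 < ρ) {A : H → Set H} (hA : IsMonotone A)
    {B D : ∀ i, G i → Set (G i)} {L : ∀ i, H →L[ℝ] G i} {r : ∀ i, G i} {z : H} (hm : 0 < m)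
    {v : ∀ i, G i} (hv : IsDualSolution ρ A B D L r z v) :
    ∃ x, resolventOp (ρ⁻¹ • A)
        (ρ⁻¹ • (z - ∑ i, ContinuousLinearMap.adjoint (L i) (v i))) = {x} ∧
      z - ρ • x ∈ compositeOp A B D L r x := by
  -- Some index must exist: a component of the dual inclusion is what shows that the resolvent value
  -- is nonempty.
  obtain ⟨_, ⟨_, ⟨x, hx, -⟩, -⟩, -⟩ := hv ⟨0, hm⟩
  have hxA := (mem_resolventOp_smul_iff hρ.ne').1 hx
  have huniq : ∀ y ∈ resolventOp (ρ⁻¹ • A)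
      (ρ⁻¹ • (z - ∑ i, ContinuousLinearMap.adjoint (L i) (v i))), y = x := fun y hy =>
    hA.eq_of_sub_smul_mem hρ ((mem_resolventOp_smul_iff hρ.ne').1 hy) hxA
  refine ⟨x, Set.eq_singleton_iff_unique_mem.2 ⟨hx, huniq⟩,
    mem_compositeOp_iff.2 ⟨_, hxA, v, fun i => ?_, by abel⟩⟩
  obtain ⟨_, ⟨_, ⟨y, hy, rfl⟩, b, hb, rfl⟩, d, hd, h⟩ := hv i
  rw [huniq y hy] at h
  refine mem_parSum.2 ⟨b, d, hb, hd, ?_⟩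
  rw [← show L i x - b - d = r i from h]
  abel

end CompositeOp

end MonotoneInclusion

/-! ### The main result. -/

theorem propositionp {H : Type*} [NormedAddCommGroup H] [InnerProductSpace ℝ H]
    [CompleteSpace H] (m : ℕ) (hm : 0 < m) (G : Fin m → Type*)
    [∀ i, NormedAddCommGroup (G i)] [∀ i, InnerProductSpace ℝ (G i)]
    [∀ i, CompleteSpace (G i)]
    (ρ : ℝ) (hρ : 0 < ρ)
    (A : H → Set H) (hA : IsMaximallyMonotone A)
    (r : ∀ i, G i)
    (B : ∀ i, G i → Set (G i)) (hB : ∀ i, IsMaximallyMonotone (B i))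
    (ν : Fin m → ℝ) (hν : ∀ i, 0 < ν i)
    (D : ∀ i, G i → Set (G i)) (hD : ∀ i, IsMaximallyMonotone (D i))
    (hDν : ∀ i, IsStronglyMonotone (ν i) (D i))
    (L : ∀ i, H →L[ℝ] G i) (hL : ∀ i, L i ≠ 0) :
    -- the statements on primal and dual solutions, for `z` satisfying the range condition
    (∀ z : H, z ∈ ranOp (compositeOp A B D L r + ρ • idOp) →
      ∃ xbar : H,
        resolventOp (ρ⁻¹ • compositeOp A B D L r) (ρ⁻¹ • z) = {xbar} ∧
        (∀ x, IsPrimalSolution ρ A B D L r z x ↔ x = xbar) ∧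
        (∃ v : ∀ i, G i, IsDualSolution ρ A B D L r z v) ∧
        (∀ v : ∀ i, G i, IsDualSolution ρ A B D L r z v →
          resolventOp (ρ⁻¹ • A)
            (ρ⁻¹ • (z - ∑ i, ContinuousLinearMap.adjoint (L i) (v i))) = {xbar})) ∧
    -- the range condition for every `z`
    ((∀ z : H, z ∈ ranOp (compositeOp A B D L r + ρ • idOp)) ↔
      IsMaximallyMonotone (compositeOp A B D L r)) ∧
    -- the conical hull condition
    (IsClosedSubspace (coneHull (qualSet A B D L r)) →
      IsMaximallyMonotone (compositeOp A B D L r)) ∧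
    -- the conditions for subdifferentials
    (∀ (f : H → EReal) (g l : ∀ i, G i → EReal),
      IsGammaZero f → A = subdiff f →
      (∀ i, IsGammaZero (g i) ∧ B i = subdiff (g i)) →
      (∀ i, IsGammaZero (l i) ∧ IsStronglyConvex (l i) ∧ D i = subdiff (l i)) →
      (WithLp.toLp 2 r ∈ sri (qualSetFun f g l L) ∨
        (∀ i, IsRealValued (g i) ∨ IsRealValued (l i)) ∨
        (FiniteDimensional ℝ H ∧ (∀ i, FiniteDimensional ℝ (G i)) ∧
          ∃ x ∈ intrinsicInterior ℝ (effDom f), ∀ i,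
            L i x - r i ∈ intrinsicInterior ℝ (effDom (g i)) +
              intrinsicInterior ℝ (effDom (l i)))) →
      IsMaximallyMonotone (compositeOp A B D L r)) := by

  have hpar := fun i => (hB i).parSum (hD i) (hν i) (hDν i)
  have hM := isMonotone_compositeOp hA.1 hpar L r
  refine ⟨fun z hz => ?_, ?_, isMaximallyMonotone_compositeOp_of_qualSet hA hpar, ?_⟩
  · obtain ⟨x, hx⟩ := mem_ranOp_add_smul_idOp_iff.1 hz
    refine ⟨x, Set.eq_singleton_iff_unique_mem.2 ⟨(mem_resolventOp_smul_iff hρ.ne').2 hx,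
      fun y hy => hM.eq_of_sub_smul_mem hρ ((mem_resolventOp_smul_iff hρ.ne').1 hy) hx⟩,
      fun y => ⟨fun hy => hM.eq_of_sub_smul_mem hρ (isPrimalSolution_iff.1 hy) hx, ?_⟩,
      exists_isDualSolution hρ.ne' hx, fun v hv => ?_⟩
    · rintro rfl
      exact isPrimalSolution_iff.2 hx
    · obtain ⟨y, hy, hyM⟩ := hv.exists_primal hρ hA.1 hm
      rw [hy, hM.eq_of_sub_smul_mem hρ hyM hx]
  · simp only [mem_ranOp_add_smul_idOp_iff]
    exact (hM.isMaximallyMonotone_iff hρ).symm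
  · rintro f g l hf rfl hg hl hcond
    obtain rfl : B = fun i => subdiff (g i) := funext fun i => (hg i).2
    obtain rfl : D = fun i => subdiff (l i) := funext fun i => (hl i).2.2
    have hg' := fun i => (hg i).1
    have hl' := fun i => (hl i).1
    refine isMaximallyMonotone_compositeOp_of_mem_sri hf hA hg' hl' hpar ?_
    rcases hcond with h | h | ⟨-, hG, x, hx, hxr⟩
    · exact h
    · exact mem_sri_qualSetFun_of_isRealValued hf hg' hl' L h _
    · exact mem_sri_qualSetFun_of_mem_intrinsicInterior hf hg' hl' hx hxr
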